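/- **Setting.** A dynamic graph is a sequence of finite simple undirected graphs $\mathcal G^0,\dots,\mathcal G^T$, where $\mathcal G^t$ ($t\ge 1$) arises from $\mathcal G^{t-1}$ by a finite sequence $\Delta\mathcal G^t$ of $M_t$ edge events (insertion of an absent edge or deletion of a present edge); put $M_0=0$. The node set $\mathcal V^t$ of $\mathcal G^t$ consists of the vertices of positive degree; write $n_t=|\mathcal V^t|$, $m_t$ for the number of edges of $\mathcal G^t$, and $\bar d^t=2m_t/n_t$ for its average degree. Nodes may arrive, but a node of a snapshot is a node of all later snapshots: $\mathcal V^0\subseteq\dots\subseteq\mathcal V^T$. Fix a teleport probability $\alpha\in(0,1]$, a precision $\epsilon\in(0,2]$, and hash functions $h_d$ (from nodes to $\{1,\dots,d\}$) and $h_{\mathrm{sgn}}$ (from nodes to $\{\pm1\}$). **Algorithm.** For each target node $s$, DynamicPPE keeps an estimate vector $p$ and a residual vector $r$. At the first snapshot that contains $s$ it sets $p=0$, $r=\mathbf 1_s$ and runs DynamicSNE with an empty batch; at every later snapshot $t$ it runs DynamicSNE with the batch $\Delta\mathcal G^t$. DynamicSNE at snapshot $t$ works with $\epsilon^t=\epsilon/m_t$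 for $t\ge1$ and $\epsilon^0=1/m_0$, as follows. 1. For every edge event in turn and both orientations $(u,v)$ of its edge, with $d(u)$ the degree right after the event, let $\Delta=p(u)/(d(u)-1)$ for an insertion ($0$ if $d(u)=1$) and $\Delta=-p(u)/(d(u)+1)$ for a deletion; then $p(u)\mathrel{+}=\Delta$, $r(u)\mathrel{-}=\Delta/\alpha$, $r(v)\mathrel{+}=\Delta/\alpha-\Delta$. 2. While some $u$ has $r(u)>\epsilon^t d(u)$, push one such $u$; then, while some $u$ has $r(u)<-\epsilon^t d(u)$, push one such $u$. Pushing $u$ means: $p(u)\mathrel{+}=\alpha r(u)$, $r(v)\mathrel{+}=(1-\alpha)r(u)/d(u)$ for all neighbours $v$ of $u$, $r(u)=0$. 3. Form $w\in\mathbb R^d$ by $w=0$ and $w(h_d(i))\mathrel{+}=h_{\mathrm{sgn}}(i)\max(\log(p(i)n_t),0)$ for all $i\in\mathcal V^t$ with $p(i)\neq0$ (the maximum is read as $0$ if $p(i)<0$). Each real operation, hash evaluation, access to a stored sparse vector, to the graph or to the queue of frontier nodes, and creation of a zero vector costs $O(1)$. So a push of $u$ costs $1+d(u)$, an orientation of an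 edge event costs $1$, filling the queue of either loop costs one step per nonzero residual, and step 3 costs one step per node $i$ with $p(i)\ne0$. Each batch is also read once, and is checked for each target node that has not yet appeared. **Theorem.** There is an absolute constant $C$ such that, in this setting, for every $1\le k\le n_T$ and every rule by which the loops choose the pushed nodes, the expected running time of DynamicPPE over the snapshots $0,\dots,T$, for a uniformly random set $S\subseteq\mathcal V^T$ of $k$ target nodes, is at most $$C\sum_{t=0}^{T}\left(\frac{k\,M_t}{\alpha^2}+\frac{k\,M_t\,\bar d^{\,t}}{\epsilon\,\alpha^2}+\frac{k\,m_t}{\epsilon\,\alpha}+k\min\Big\{n_t,\frac{m_t}{\epsilon\alpha}\Big\}\right).$$ In particular, all the loops terminate. The sum of the last terms is at most $k(T+1)\min\{n,\frac{m}{\epsilon\alpha}\}$ with $n=\max_t n_t$ and $m=\max_t m_t$. -/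

import Mathlib

open scoped Classical ENNReal

namespace DynPPE

/-! ### Dynamic graphs -/

inductive EdgeOp where
  | insert
  | delete

/-- An edge event `(u, v, event)`; the edge `{u, v}` is undirected. -/
structure EdgeEvent (V : Type*) where
  u : V
  v : V
  op : EdgeOp

/-- The graph after the event. -/
def EdgeEvent.apply {V : Type*} (e : EdgeEvent V) (G : SimpleGraph V) : SimpleGraph V :=
  match e.op with
  | .insert => G ⊔ SimpleGraph.edge e.u e.v
  | .delete => G.deleteEdges {s(e.u, e.v)}

/-- Only absent non-loop edges are inserted and only present edges are deleted. -/
def EdgeEvent.Valid {V : Type*} (e : EdgeEvent V) (G : SimpleGraph V) : Prop :=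
  match e.op with
  | .insert => e.u ≠ e.v ∧ ¬ G.Adj e.u e.v
  | .delete => G.Adj e.u e.v

/-- Every event of the batch is valid in the graph left by the events before it. -/
def ValidBatch {V : Type*} : SimpleGraph V → List (EdgeEvent V) → Prop
  | _, [] => True
  | G, e :: es => e.Valid G ∧ ValidBatch (e.apply G) es

/-- The graph after a whole batch. -/
def applyBatch {V : Type*} (G : SimpleGraph V) (es : List (EdgeEvent V)) : SimpleGraph V :=
  es.foldl (fun H e => e.apply H) G

/-- An initial graph and update batches: `batch t` leads from snapshot `t` to snapshot `t + 1`. -/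
structure DynamicGraph (V : Type*) where
  initial : SimpleGraph V
  batch : ℕ → List (EdgeEvent V)

namespace DynamicGraph

variable {V : Type*}

def snapshot (D : DynamicGraph V) : ℕ → SimpleGraph V
  | 0 => D.initial
  | t + 1 => applyBatch (D.snapshot t) (D.batch t)

/-- The number of edge events processed at snapshot `t` (none at the initial snapshot). -/
def numEvents (D : DynamicGraph V) : ℕ → ℕ
  | 0 => 0
  | t + 1 => (D.batch t).length

/-- The nodes of snapshot `t`: the vertices that carry an edge. -/
noncomputable def nodes [Fintype V] (D : DynamicGraph V) (t : ℕ) : Finset V :=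
  (D.snapshot t).support.toFinset

noncomputable def numNodes [Fintype V] (D : DynamicGraph V) (t : ℕ) : ℕ :=
  (D.nodes t).card

noncomputable def numEdges [Fintype V] (D : DynamicGraph V) (t : ℕ) : ℕ :=
  (D.snapshot t).edgeFinset.card

/-- The average degree of snapshot `t`. -/
noncomputable def avgDegree [Fintype V] (D : DynamicGraph V) (t : ℕ) : ℝ :=
  2 * D.numEdges t / D.numNodes t

end DynamicGraph

/-! ### Programs with a step count

Arithmetic operations and comparisons of reals, evaluations of the hash functions, accesses to a
stored (sparse) vector, the graph or the queue of frontier nodes, and the creation of a zero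
vector cost one step, up to a constant. -/

/-- The result of a computation with the number of steps it takes (`⊤` if it does not stop). -/
structure Timed (β : Type*) where
  val : β
  time : ℕ∞

/-- An estimate vector and a residual vector. -/
structure PushState (V : Type*) where
  p : V → ℝ
  r : V → ℝ

/-- `p = 0` and `r = 1_s`. -/
noncomputable def PushState.start {V : Type*} (s : V) : PushState V :=
  ⟨fun _ => 0, fun x => if x = s then 1 else 0⟩

/-! ### The local push -/

section Push

variable {V : Type*} [Fintype V]

/-- `Push(u)` with `β = 0`. -/
noncomputable def push (α : ℝ) (G : SimpleGraph V) (u : V) (st : PushState V) : PushState V where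
  p := fun x => if x = u then st.p u + α * st.r u else st.p x
  r := fun x => if x = u then 0 else
    if G.Adj u x then st.r x + (1 - α) * st.r u / G.degree u else st.r x

/-- A rule by which a loop picks a node of its (nonempty) frontier, given the number of the
iteration. Every order of the pushes comes from such a rule. -/
structure Scheduler (V : Type*) where
  pick : ℕ → Finset V → V
  pick_mem : ∀ j F, F.Nonempty → pick j F ∈ F

noncomputable def posFrontier (G : SimpleGraph V) (δ : ℝ) (st : PushState V) : Finset V :=
  Finset.univ.filter fun u => st.r u > δ * G.degree u

noncomputable def negFrontier (G : SimpleGraph V) (δ : ℝ) (st : PushState V) : Finset V :=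
  Finset.univ.filter fun u => st.r u < -(δ * G.degree u)

/-- The state after `j` iterations of `while the frontier F is nonempty: Push(some u in F)`. -/
noncomputable def loopState (α : ℝ) (G : SimpleGraph V) (F : PushState V → Finset V)
    (σ : Scheduler V) (st : PushState V) : ℕ → PushState V
  | 0 => st
  | j + 1 =>
    let cur := loopState α G F σ st j
    if (F cur).Nonempty then push α G (σ.pick j (F cur)) cur else cur

/-- The steps of iteration `j`: one for the pushed node and one for each of its neighbours. -/
noncomputable def iterTime (α : ℝ) (G : SimpleGraph V) (F : PushState V → Finset V)
    (σ : Scheduler V) (st : PushState V) (j : ℕ) : ℕ :=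
  let cur := loopState α G F σ st j
  if (F cur).Nonempty then 1 + G.degree (σ.pick j (F cur)) else 0

/-- The loop `while the frontier F is nonempty: Push(some u in F)`. The frontier queue is first
filled by a scan of the nonzero residuals; one more step is the final test. If the loop never
stops, its time is `⊤` and its result is immaterial. -/
noncomputable def pushLoop (α : ℝ) (G : SimpleGraph V) (F : PushState V → Finset V)
    (σ : Scheduler V) (st : PushState V) : Timed (PushState V) where
  val := if h : ∃ N, F (loopState α G F σ st N) = ∅
    then loopState α G F σ st (Nat.find h) else st
  time := ((Finset.univ.filter fun u => st.r u ≠ 0).card + 1 : ℕ) +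
    ⨆ N : ℕ, ((∑ j ∈ Finset.range N, iterTime α G F σ st j : ℕ) : ℕ∞)

/-- `ForwardPush`: first the loop over the positive residuals, then over the negative ones. -/
noncomputable def forwardPush (α : ℝ) (G : SimpleGraph V) (δ : ℝ) (σpos σneg : Scheduler V)
    (st : PushState V) : Timed (PushState V) :=
  let first := pushLoop α G (posFrontier G δ) σpos st
  let second := pushLoop α G (negFrontier G δ) σneg first.val
  ⟨second.val, first.time + second.time⟩

/-! ### DynamicSNE -/

/-- The update of `p` and `r` for one direction `(u, v)` of an edge event; `G` is the graph right
after the event. -/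
noncomputable def adjust (α : ℝ) (G : SimpleGraph V) (op : EdgeOp) (u v : V)
    (st : PushState V) : PushState V :=
  let Δ : ℝ := match op with
    | .insert => st.p u / ((G.degree u : ℝ) - 1)
    | .delete => -(st.p u / ((G.degree u : ℝ) + 1))
  { p := fun x => if x = u then st.p u + Δ else st.p x
    r := fun x => if x = u then st.r u - Δ / α else
      if x = v then st.r v + Δ / α - Δ else st.r x }

/-- The loop over the edge events; each undirected event is processed in both directions. `G` is
the graph before the batch. -/
noncomputable def processBatch (α : ℝ) :
    SimpleGraph V → List (EdgeEvent V) → PushState V → Timed (PushState V)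
  | _, [], st => ⟨st, 0⟩
  | G, e :: es, st =>
    let G' := e.apply G
    let rest := processBatch α G' es
      (adjust α G' e.op e.v e.u (adjust α G' e.op e.u e.v st))
    ⟨rest.val, 2 + rest.time⟩

/-- The hash kernel projection of the estimates onto `ℝ^dim`, one step for every node with a nonzero
estimate. -/
noncomputable def project {dim : ℕ} (hd : V → Fin dim) (hsgn : V → ℤˣ) (G : SimpleGraph V)
    (p : V → ℝ) : Timed (Fin dim → ℝ) where
  val := fun i => ∑ x ∈ G.support.toFinset with p x ≠ 0 ∧ hd x = i,
    ((hsgn x : ℤ) : ℝ) *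
      (if 0 < p x then max (Real.log (p x * G.support.toFinset.card)) 0 else 0)
  time := ((G.support.toFinset.filter fun x => p x ≠ 0).card : ℕ)

/-- `DynamicSNE` for the graph `G` before the batch `es`, precision `δ` and the previous estimate
and residual vectors `st` of the target node; it returns the new vectors and the embedding. -/
noncomputable def dynamicSNE {dim : ℕ} (α : ℝ) (hd : V → Fin dim) (hsgn : V → ℤˣ)
    (G : SimpleGraph V) (es : List (EdgeEvent V)) (δ : ℝ) (σpos σneg : Scheduler V)
    (st : PushState V) : Timed (PushState V × (Fin dim → ℝ)) :=
  let G' := applyBatch G es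
  let a := processBatch α G es st
  let b := forwardPush α G' δ σpos σneg a.val
  let c := project hd hsgn G' b.val.p
  ⟨(b.val, c.val), a.time + b.time + c.time⟩

/-! ### DynamicPPE -/

/-- The precision used at snapshot `t`. -/
noncomputable def precision (D : DynamicGraph V) (ε : ℝ) : ℕ → ℝ
  | 0 => 1 / D.numEdges 0
  | t + 1 => ε / D.numEdges (t + 1)

/-- The work of `DynamicPPE` for the target node `s` at snapshot `t`; its value is `none` as long
as `s` has not appeared in the graph. The node is initialised, with an empty batch, at the first
snapshot that contains it; until then every batch is checked for it. -/
noncomputable def targetStep {dim : ℕ} (D : DynamicGraph V) (α ε : ℝ) (hd : V → Fin dim)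
    (hsgn : V → ℤˣ) (σpos σneg : ℕ → V → Scheduler V) (s : V) :
    ℕ → Timed (Option (PushState V × (Fin dim → ℝ)))
  | 0 =>
    if s ∈ D.nodes 0 then
      let c := dynamicSNE α hd hsgn (D.snapshot 0) [] (precision D ε 0)
        (σpos 0 s) (σneg 0 s) (PushState.start s)
      ⟨some c.val, 1 + c.time⟩
    else ⟨none, 1⟩
  | t + 1 =>
    match (targetStep D α ε hd hsgn σpos σneg s t).val with
    | some (st, _) =>
      let c := dynamicSNE α hd hsgn (D.snapshot t) (D.batch t) (precision D ε (t + 1))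
        (σpos (t + 1) s) (σneg (t + 1) s) st
      ⟨some c.val, c.time⟩
    | none =>
      if s ∈ D.nodes (t + 1) then
        let c := dynamicSNE α hd hsgn (D.snapshot (t + 1)) [] (precision D ε (t + 1))
          (σpos (t + 1) s) (σneg (t + 1) s) (PushState.start s)
        ⟨some c.val, (D.numEvents (t + 1) : ℕ∞) + 1 + c.time⟩
      else ⟨none, (D.numEvents (t + 1) : ℕ∞)⟩

/-- `DynamicPPE` for the target set `S` over the snapshots `0, …, T`: the embeddings of the target
nodes at all snapshots, and the time, which consists of reading every batch once and of the work
for every target node at every snapshot. -/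
noncomputable def dynamicPPE {dim : ℕ} (D : DynamicGraph V) (T : ℕ) (S : Finset V) (α ε : ℝ)
    (hd : V → Fin dim) (hsgn : V → ℤˣ) (σpos σneg : ℕ → V → Scheduler V) :
    Timed (S → Fin (T + 1) → Option (Fin dim → ℝ)) where
  val := fun s t => (targetStep D α ε hd hsgn σpos σneg s t).val.map Prod.snd
  time := ∑ t ∈ Finset.range (T + 1), ((D.numEvents t : ℕ∞) +
    ∑ s ∈ S, (targetStep D α ε hd hsgn σpos σneg s t).time)

end Push

end DynPPE

/-!
The running time is governed by the pushes, and a push of `u` with `|r(u)| > δ d(u)` destroys at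
least `α δ d(u)` of the total residual `‖r‖₁` (`mass_push_add_le`). Both loops of a run therefore
cost `O(‖r‖₁ / (α δ))` steps, where `‖r‖₁` is the residual after the batch, and they terminate
(`pushLoop_spec`, `forwardPush_spec`). With `δ = ε / m` this is `O(‖r‖₁ m / (ε α))`.

The previous run leaves `|r| ≤ δ d`, hence `‖r‖₁ ≤ 2 m δ = O(1)`. An event with the edge `{u, v}`
adds at most `2 / α` times `|p(u)| / d(u) + |p(v)| / d(v)`, and no event increases any
`|p(x)| / d(x)`, so these ratios may be taken before the batch (`Balanced.update`,
`processBatch_spec`).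

For a single target node the ratios can be large, but their sum over all target nodes is at most
`5` at each `x`. The invariant `p + α r = (1 - α) A D⁻¹ p + α 1_s`, preserved by pushes and events,
says that `p(x) / d(x)` is `1 - α` times its mean over the neighbours of `x` plus an error of size
at most `α (1_s(x) / d(x) + δ)`. After summation over `s` the errors are at most `α (1 + n δ)`, and
the maximum principle gives the bound `1 + n δ ≤ 1 + 2 m δ ≤ 5` (`sum_abs_perDegree_le`). Hence
the mean over the `n_T ≥ n_t` nodes of the residual created by `M` events is `O(M / (α n_t))`,
which yields the term `M d̄ / (ε α²)`.

By the invariant, residuals vanish outside the graph, so the queues, like the projection, cost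
`O(n) = O(m / (ε α))` steps.
-/

namespace DynPPE

/-! ### The effect of an edge event on a graph -/

section Events

variable {V : Type*} [Fintype V]

lemma sum_neighborFinset_of_eq_sup_edge {H H' : SimpleGraph V} {u v : V}
    (hH' : H' = H ⊔ SimpleGraph.edge u v) (huv : u ≠ v) (hadj : ¬ H.Adj u v) (f : V → ℝ) (x : V) :
    ∑ w ∈ H'.neighborFinset x, f w = ∑ w ∈ H.neighborFinset x, f w +
      ((if x = u then f v else 0) + (if x = v then f u else 0)) := by
  have hadj' : ¬ H.Adj v u := fun h => hadj h.symm
  have key : ∀ w, (if H'.Adj x w then f w else 0) =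
      (if H.Adj x w then f w else 0) + ((if w = v then (if x = u then f v else 0) else 0) +
        (if w = u then (if x = v then f u else 0) else 0)) := by
    intro w
    simp only [hH', SimpleGraph.sup_adj, SimpleGraph.edge_adj]
    by_cases h1 : x = u <;> by_cases h2 : x = v <;> by_cases h3 : w = u <;>
      by_cases h4 : w = v <;> subst_vars <;> simp_all
  simp only [SimpleGraph.neighborFinset_eq_filter, Finset.sum_filter]
  rw [Finset.sum_congr rfl fun w _ => key w]
  simp [Finset.sum_add_distrib]

lemma sum_neighborFinset_one (G : SimpleGraph V) (x : V) :
    ∑ _w ∈ G.neighborFinset x, (1 : ℝ) = G.degree x := by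
  simp

/-- The amount `Δ` that one orientation of an event adds to the estimate of `u`; `G` is the graph
right after the event. -/
noncomputable def shift (G : SimpleGraph V) (op : EdgeOp) (p : V → ℝ) (u : V) : ℝ :=
  match op with
  | .insert => p u / ((G.degree u : ℝ) - 1)
  | .delete => -(p u / ((G.degree u : ℝ) + 1))

/-- The estimate of a node divided by its degree. An isolated node gets the value `0`. -/
noncomputable def perDegree (G : SimpleGraph V) (p : V → ℝ) (x : V) : ℝ :=
  p x / G.degree x

/-- An insertion (`c = 1`) and a deletion (`c = -1`) are described by the same formulas: they
change neighbourhood sums by `c` times the contribution of the edge, and `Δ = c p(u) / d(u)` in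
terms of the degree *before* the event. -/
lemma EdgeEvent.Valid.exists_sign {e : EdgeEvent V} {G : SimpleGraph V} (he : e.Valid G) :
    e.u ≠ e.v ∧ ∃ c : ℝ, (c = 1 ∨ c = -1) ∧
      (∀ (f : V → ℝ) (x : V), ∑ w ∈ (e.apply G).neighborFinset x, f w =
        ∑ w ∈ G.neighborFinset x, f w +
          c * ((if x = e.u then f e.v else 0) + (if x = e.v then f e.u else 0))) ∧
      ∀ (p : V → ℝ) (x : V), x = e.u ∨ x = e.v →
        shift (e.apply G) e.op p x = c * perDegree G p x := by
  obtain ⟨u, v, op⟩ := e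
  cases op with
  | insert =>
    obtain ⟨huv, hadj⟩ : u ≠ v ∧ ¬ G.Adj u v := he
    generalize hG' : EdgeEvent.apply ⟨u, v, .insert⟩ G = G'
    have hsum := sum_neighborFinset_of_eq_sup_edge (H' := G') hG'.symm huv hadj
    refine ⟨huv, 1, Or.inl rfl, fun f x => by simpa using hsum f x, ?_⟩
    intro p x hx
    have hd := hsum (fun _ => 1) x
    rw [sum_neighborFinset_one, sum_neighborFinset_one] at hd
    simp only [shift, perDegree, one_mul]
    rw [hd]
    rcases hx with rfl | rfl
    · simp [huv]
    · simp [huv.symm]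
  | delete =>
    have hadj : G.Adj u v := he
    have huv : u ≠ v := hadj.ne
    generalize hG' : EdgeEvent.apply ⟨u, v, .delete⟩ G = G'
    have hG'' : G.deleteEdges {s(u, v)} = G' := hG'
    have hG : G = G' ⊔ SimpleGraph.edge u v := by
      ext a b
      simp only [← hG'', SimpleGraph.sup_adj, SimpleGraph.deleteEdges_adj, SimpleGraph.edge_adj,
        Set.mem_singleton_iff, Sym2.eq_iff]
      constructor
      · intro h
        have := h.ne
        tauto
      · rintro (h | ⟨⟨rfl, rfl⟩ | ⟨rfl, rfl⟩, -⟩)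
        exacts [h.1, hadj, hadj.symm]
    have hsum := sum_neighborFinset_of_eq_sup_edge hG huv (by simp [← hG''])
    refine ⟨huv, -1, Or.inr rfl, fun f x => ?_, ?_⟩
    · simp only [hsum]
      ring
    intro p x hx
    have hd := hsum (fun _ => 1) x
    rw [sum_neighborFinset_one, sum_neighborFinset_one] at hd
    simp only [shift, perDegree]
    rw [hd]
    rcases hx with rfl | rfl
    · simp [huv]
    · simp [huv.symm]

end Events

/-! ### The invariant of the estimate and residual vectors -/

section Invariant

variable {V : Type*} [Fintype V] {α : ℝ} {G : SimpleGraph V} {s : V} {st : PushState V}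

/-- The linear relation `p + α r = (1 - α) A D⁻¹ p + α 1_s` between estimates and residuals, with
no estimate on isolated nodes. -/
structure Balanced (α : ℝ) (G : SimpleGraph V) (s : V) (st : PushState V) : Prop where
  isolated : ∀ x, G.degree x = 0 → st.p x = 0
  balance : ∀ x, st.p x + α * st.r x =
    (1 - α) * ∑ w ∈ G.neighborFinset x, perDegree G st.p w + if x = s then α else 0

/-- The total residual `‖r‖₁`. -/
noncomputable def mass (st : PushState V) : ℝ := ∑ x, |st.r x|

lemma mass_nonneg (st : PushState V) : 0 ≤ mass st :=
  Finset.sum_nonneg fun _ _ => abs_nonneg _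

lemma balanced_start (α : ℝ) (G : SimpleGraph V) (s : V) :
    Balanced α G s (PushState.start s) := by
  constructor <;> intro x <;> simp [PushState.start, perDegree]

lemma mass_start (s : V) : mass (PushState.start s) = 1 := by
  have : ∀ x, |if x = s then (1 : ℝ) else 0| = if x = s then 1 else 0 := by
    intro x; split_ifs <;> simp
  simp [mass, PushState.start, this]

/-- The target node itself is not isolated, so residual sits on nodes of the graph only. -/
lemma Balanced.residual_isolated (h : Balanced α G s st) (hα : 0 < α) (hs : G.degree s ≠ 0)
    {x : V} (hx : G.degree x = 0) : st.r x = 0 := by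
  have hb := h.balance x
  have hn : G.neighborFinset x = ∅ := Finset.card_eq_zero.1 hx
  have hxs : x ≠ s := by rintro rfl; exact hs hx
  rw [h.isolated x hx, hn] at hb
  simpa [hxs, hα.ne'] using hb

/-! ### Pushes -/

lemma Balanced.push (h : Balanced α G s st) {u : V} (hu : G.degree u ≠ 0) :
    Balanced α G s (push α G u st) := by
  have hq : ∀ w, perDegree G (DynPPE.push α G u st).p w =
      perDegree G st.p w + if w = u then α * st.r u / G.degree u else 0 := by
    intro w
    by_cases hw : w = u
    · subst hw; simp [perDegree, DynPPE.push, add_div]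
    · simp [perDegree, DynPPE.push, hw]
  constructor
  · intro x hx
    have hxu : x ≠ u := by rintro rfl; exact hu hx
    simpa [DynPPE.push, hxu] using h.isolated x hx
  · intro x
    have hb := h.balance x
    simp only [hq, Finset.sum_add_distrib, Finset.sum_ite_eq', SimpleGraph.mem_neighborFinset]
    by_cases hxu : x = u
    · subst hxu
      simp only [DynPPE.push, SimpleGraph.irrefl, if_true, if_false]
      linarith
    · by_cases hadj : G.Adj u x
      · simp only [DynPPE.push, hxu, hadj, hadj.symm, if_true, if_false]
        linear_combination hb
      · have hadj' : ¬ G.Adj x u := fun h => hadj h.symm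
        simp only [DynPPE.push, hxu, hadj, hadj', if_false]
        linarith

/-- A push of `u` destroys at least the share `α` of the residual of `u`. -/
lemma mass_push_add_le (hα : α ≤ 1) {u : V} (hu : G.degree u ≠ 0) :
    mass (push α G u st) + α * |st.r u| ≤ mass st := by
  have hd : (0 : ℝ) < G.degree u := by positivity
  have hpt : ∀ x, |(push α G u st).r x| ≤ (|st.r x| - if x = u then |st.r u| else 0) +
      if x ∈ G.neighborFinset u then (1 - α) * |st.r u| / G.degree u else 0 := by
    intro x
    simp only [SimpleGraph.mem_neighborFinset]
    by_cases hxu : x = u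
    · subst hxu; simp [push]
    · by_cases hadj : G.Adj u x
      · simp only [push, hxu, hadj, if_true, if_false, sub_zero]
        refine (abs_add_le _ _).trans (le_of_eq ?_)
        rw [abs_div, abs_mul, abs_of_nonneg (sub_nonneg.2 hα), abs_of_pos hd]
      · simp [push, hxu, hadj]
  have hsum := Finset.sum_le_sum fun x (_ : x ∈ Finset.univ) => hpt x
  rw [Finset.sum_add_distrib, Finset.sum_sub_distrib, Finset.sum_ite_eq', Finset.sum_ite_mem,
    Finset.univ_inter, Finset.sum_const, SimpleGraph.card_neighborFinset_eq_degree,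
    nsmul_eq_mul, mul_div_cancel₀ _ hd.ne'] at hsum
  simp only [Finset.mem_univ, if_true] at hsum
  unfold mass
  linarith

/-! ### Edge events -/

lemma adjust_p (op : EdgeOp) (u v x : V) :
    (adjust α G op u v st).p x = st.p x + if x = u then shift G op st.p u else 0 := by
  by_cases hx : x = u
  · subst hx; cases op <;> simp [adjust, shift]
  · simp [adjust, hx]

lemma adjust_r (op : EdgeOp) {u v : V} (huv : u ≠ v) (x : V) :
    (adjust α G op u v st).r x = st.r x + ((if x = u then -(shift G op st.p u / α) else 0) +
      if x = v then shift G op st.p u / α - shift G op st.p u else 0) := by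
  by_cases hx : x = u
  · subst hx; cases op <;> simp [adjust, shift, huv] <;> ring
  · by_cases hv : x = v
    · subst hv; cases op <;> simp [adjust, shift, hx] <;> ring
    · simp [adjust, hx, hv]

/-- The state after both orientations of an event; `G` is the graph before the event. -/
noncomputable def EdgeEvent.update (α : ℝ) (G : SimpleGraph V) (e : EdgeEvent V)
    (st : PushState V) : PushState V :=
  adjust α (e.apply G) e.op e.v e.u (adjust α (e.apply G) e.op e.u e.v st)

/-- The closed form of the update, with `c = ±1` as in `EdgeEvent.Valid.exists_sign`. -/
lemma EdgeEvent.update_eq {e : EdgeEvent V} (huv : e.u ≠ e.v) {c : ℝ}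
    (hc : ∀ (p : V → ℝ) (x : V), x = e.u ∨ x = e.v →
        shift (e.apply G) e.op p x = c * perDegree G p x) (x : V) :
    (e.update α G st).p x = st.p x + ((if x = e.u then c * perDegree G st.p e.u else 0) +
        if x = e.v then c * perDegree G st.p e.v else 0) ∧
    (e.update α G st).r x = st.r x +
      (((if x = e.u then -(c * perDegree G st.p e.u / α) else 0) +
        if x = e.v then c * perDegree G st.p e.u / α - c * perDegree G st.p e.u else 0) +
      ((if x = e.v then -(c * perDegree G st.p e.v / α) else 0) +
        if x = e.u then c * perDegree G st.p e.v / α - c * perDegree G st.p e.v else 0)) := by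
  have h1 := hc st.p e.u (Or.inl rfl)
  have h2 : shift (e.apply G) e.op (adjust α (e.apply G) e.op e.u e.v st).p e.v =
      c * perDegree G st.p e.v := by
    rw [hc _ _ (Or.inr rfl), perDegree, adjust_p, if_neg huv.symm, add_zero, perDegree]
  unfold EdgeEvent.update
  rw [adjust_p, adjust_p, adjust_r _ huv.symm, adjust_r _ huv, h1, h2]
  constructor <;> ring

/-- An event preserves the invariant, does not increase the estimates per degree, and creates
residual in proportion to the estimates per degree of the two ends of its edge. -/
lemma Balanced.update (h : Balanced α G s st) (hα : 0 < α) (hα1 : α ≤ 1) {e : EdgeEvent V}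
    (he : e.Valid G) :
    Balanced α (e.apply G) s (e.update α G st) ∧
    (∀ x, |perDegree (e.apply G) (e.update α G st).p x| ≤ |perDegree G st.p x|) ∧
    mass (e.update α G st) ≤
      mass st + 2 / α * (|perDegree G st.p e.u| + |perDegree G st.p e.v|) := by
  obtain ⟨huv, c, hc1, hsum, hc⟩ := he.exists_sign
  have hup := fun x => (EdgeEvent.update_eq (α := α) (st := st) huv hc x).1
  have hur := fun x => (EdgeEvent.update_eq (α := α) (st := st) huv hc x).2
  have hc0 : c ≠ 0 := by rcases hc1 with rfl | rfl <;> norm_num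
  have hdeg : ∀ x, ((e.apply G).degree x : ℝ) =
      G.degree x + c * ((if x = e.u then 1 else 0) + (if x = e.v then 1 else 0)) := by
    intro x
    rw [← sum_neighborFinset_one, ← sum_neighborFinset_one]
    exact hsum _ x
  generalize e.apply G = G' at *
  generalize e.update α G st = st' at *
  obtain ⟨u, v, op⟩ := e
  simp only at *
  -- At an end of the edge both the estimate and the degree move by the same factor.
  have hend : ∀ x, x = u ∨ x = v → st'.p x = st.p x + c * perDegree G st.p x ∧
      (G'.degree x : ℝ) = G.degree x + c := by
    rintro x (rfl | rfl)
    · exact ⟨by simp [hup, huv], by simp [hdeg, huv]⟩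
    · exact ⟨by simp [hup, huv.symm], by simp [hdeg, huv.symm]⟩
  -- Only the deletion of the last edge at `x` isolates it, and then `Δ = -p(x)`.
  have hiso : ∀ x, G'.degree x = 0 → st'.p x = 0 := by
    intro x hx
    have hx' : (G'.degree x : ℝ) = 0 := by exact_mod_cast hx
    by_cases hxe : x = u ∨ x = v
    · obtain ⟨h1, h2⟩ := hend x hxe
      have : (G.degree x : ℝ) = -c := by linarith
      rw [h1, perDegree, this]
      field_simp
      ring
    · push Not at hxe
      have h2 := hdeg x
      rw [if_neg hxe.1, if_neg hxe.2, hx'] at h2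
      have : G.degree x = 0 := by
        have : (G.degree x : ℝ) = 0 := by linarith
        exact_mod_cast this
      rw [hup, if_neg hxe.1, if_neg hxe.2, h.isolated x this]
      simp
  -- If `x` was isolated before, the quotient on the right is `0 / 0 = 0`, and so is `p(x)`.
  have hq : ∀ x, G'.degree x ≠ 0 → perDegree G' st'.p x = perDegree G st.p x := by
    intro x hx
    have hx' : (G'.degree x : ℝ) ≠ 0 := by exact_mod_cast hx
    by_cases hxe : x = u ∨ x = v
    · obtain ⟨h1, h2⟩ := hend x hxe
      by_cases h0 : G.degree x = 0
      · simp [perDegree, h1, h.isolated x h0]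
      · have h0' : (G.degree x : ℝ) ≠ 0 := by exact_mod_cast h0
        rw [perDegree, h1, perDegree]
        rw [h2] at hx' ⊢
        field_simp
    · push Not at hxe
      have h2 := hdeg x
      rw [if_neg hxe.1, if_neg hxe.2] at h2
      simp [perDegree, hup, h2, hxe.1, hxe.2]
  refine ⟨⟨hiso, fun x => ?_⟩, fun x => ?_, ?_⟩
  · have hq' : ∑ w ∈ G'.neighborFinset x, perDegree G' st'.p w =
        ∑ w ∈ G'.neighborFinset x, perDegree G st.p w := by
      refine Finset.sum_congr rfl fun w hw => hq w ?_
      rw [SimpleGraph.mem_neighborFinset] at hw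
      exact (G'.degree_pos_iff_exists_adj w |>.2 ⟨x, hw.symm⟩).ne'
    have hb := h.balance x
    rw [hq', hsum, hup, hur]
    by_cases hxu : x = u
    · subst hxu
      simp only [if_true, if_neg huv]
      field_simp
      linarith
    · by_cases hxv : x = v
      · subst hxv
        simp only [if_true, if_neg huv.symm]
        field_simp
        linarith
      · simp only [if_neg hxu, if_neg hxv]
        linarith
  · by_cases hx : G'.degree x = 0
    · simp [perDegree, hx]
    · rw [hq x hx]
  · set a := |perDegree G st.p u|
    set b := |perDegree G st.p v|
    have hcabs : |c| = 1 := by rcases hc1 with rfl | rfl <;> simp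
    have h1α : 0 ≤ 1 / α - 1 := by
      rw [sub_nonneg, le_div_iff₀ hα]
      linarith
    have h1 : ∀ y : ℝ, |-(c * y / α)| = |y| / α := by
      intro y
      rw [abs_neg, abs_div, abs_mul, hcabs, one_mul, abs_of_pos hα]
    have h2 : ∀ y : ℝ, |c * y / α - c * y| = |y| * (1 / α - 1) := by
      intro y
      rw [show c * y / α - c * y = c * y * (1 / α - 1) by ring, abs_mul, abs_mul, hcabs, one_mul,
        abs_of_nonneg h1α]
    have hpt : ∀ x, |st'.r x| ≤ |st.r x| +
        ((if x = u then a / α + b * (1 / α - 1) else 0) +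
          if x = v then a * (1 / α - 1) + b / α else 0) := by
      intro x
      rw [hur]
      refine (abs_add_le _ _).trans (add_le_add_right ?_ _)
      by_cases hxu : x = u
      · subst hxu
        simp only [if_true, if_neg huv, add_zero, zero_add]
        exact (abs_add_le _ _).trans (by rw [h1, h2])
      · by_cases hxv : x = v
        · subst hxv
          simp only [if_true, if_neg huv.symm, add_zero, zero_add]
          exact (abs_add_le _ _).trans (by rw [h1, h2])
        · simp [hxu, hxv]
    have hs := Finset.sum_le_sum fun x (_ : x ∈ Finset.univ) => hpt x
    rw [Finset.sum_add_distrib, Finset.sum_add_distrib, Finset.sum_ite_eq',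
      Finset.sum_ite_eq'] at hs
    simp only [Finset.mem_univ, if_true] at hs
    have ha : 0 ≤ a := abs_nonneg _
    have hb : 0 ≤ b := abs_nonneg _
    unfold mass
    have : a / α + b * (1 / α - 1) + (a * (1 / α - 1) + b / α) = 2 / α * (a + b) - (a + b) := by
      ring
    linarith

end Invariant
/-! ### Real bounds on step counts -/

/-- A step count is finite and at most the real number `b`. -/
def TimeLE (a : ℕ∞) (b : ℝ) : Prop := ∃ n : ℕ, a ≤ n ∧ (n : ℝ) ≤ b

namespace TimeLE

lemma natCast (n : ℕ) : TimeLE n n := ⟨n, le_rfl, le_rfl⟩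

lemma mono {a : ℕ∞} {b b' : ℝ} (h : TimeLE a b) (hb : b ≤ b') : TimeLE a b' :=
  let ⟨n, h1, h2⟩ := h
  ⟨n, h1, h2.trans hb⟩

lemma add {a a' : ℕ∞} {b b' : ℝ} (h : TimeLE a b) (h' : TimeLE a' b') :
    TimeLE (a + a') (b + b') := by
  obtain ⟨n, h1, h2⟩ := h
  obtain ⟨n', h1', h2'⟩ := h'
  exact ⟨n + n', by push_cast; exact add_le_add h1 h1', by push_cast; exact add_le_add h2 h2'⟩

lemma sum {ι : Type*} {A : Finset ι} {a : ι → ℕ∞} {b : ι → ℝ}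
    (h : ∀ i ∈ A, TimeLE (a i) (b i)) : TimeLE (∑ i ∈ A, a i) (∑ i ∈ A, b i) := by
  induction A using Finset.induction_on with
  | empty => exact ⟨0, by simp, by simp⟩
  | insert i A hi ih =>
    rw [Finset.sum_insert hi, Finset.sum_insert hi]
    exact (h i (Finset.mem_insert_self i A)).add
      (ih fun j hj => h j (Finset.mem_insert_of_mem hj))

lemma iSup {f : ℕ → ℕ} {b : ℝ} (h : ∀ N, (f N : ℝ) ≤ b) : TimeLE (⨆ N, (f N : ℕ∞)) b := by
  have hb : 0 ≤ b := (Nat.cast_nonneg _).trans (h 0)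
  exact ⟨⌊b⌋₊, iSup_le fun N => Nat.cast_le.2 (Nat.le_floor (h N)), Nat.floor_le hb⟩

lemma toENNReal_le {a : ℕ∞} {b : ℝ} (h : TimeLE a b) : (a : ℝ≥0∞) ≤ ENNReal.ofReal b := by
  obtain ⟨n, h1, h2⟩ := h
  calc (a : ℝ≥0∞) ≤ ((n : ℕ∞) : ℝ≥0∞) := ENat.toENNReal_le.2 h1
    _ = ENNReal.ofReal n := by simp
    _ ≤ ENNReal.ofReal b := ENNReal.ofReal_le_ofReal h2

end TimeLE

/-! ### The push loops -/

section Loops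

variable {V : Type*} [Fintype V] {α δ : ℝ} {G : SimpleGraph V} {s : V} {st : PushState V}

/-- A loop that preserves `P` and pushes only nodes `u` with `|r u| ≥ δ d(u) > 0` stops: every
step of it is paid for by a loss of total residual of at least `α δ / 2`. -/
lemma pushLoop_spec (hα : 0 < α) (hα1 : α ≤ 1) (hδ : 0 < δ) (F : PushState V → Finset V)
    (σ : Scheduler V) (P : PushState V → Prop) (hP : P st)
    (hF : ∀ st, P st → ∀ u ∈ F st, G.degree u ≠ 0 ∧ δ * G.degree u ≤ |st.r u|)
    (hpush : ∀ st, P st → ∀ u ∈ F st, P (push α G u st)) :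
    P (pushLoop α G F σ st).val ∧ F (pushLoop α G F σ st).val = ∅ ∧
    mass (pushLoop α G F σ st).val ≤ mass st ∧
    TimeLE (pushLoop α G F σ st).time
      (((Finset.univ.filter fun u => st.r u ≠ 0).card + 1 : ℕ) + 2 * mass st / (α * δ)) := by
  set S := loopState α G F σ st with hS
  have hgo : ∀ j, (F (S j)).Nonempty → S (j + 1) = push α G (σ.pick j (F (S j))) (S j) ∧
      iterTime α G F σ st j = 1 + G.degree (σ.pick j (F (S j))) :=
    fun j hne => ⟨if_pos hne, if_pos hne⟩
  have hidle : ∀ j, ¬ (F (S j)).Nonempty → S (j + 1) = S j ∧ iterTime α G F σ st j = 0 :=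
    fun j hne => ⟨if_neg hne, if_neg hne⟩
  have hSP : ∀ j, P (S j) := by
    intro j
    induction j with
    | zero => exact hP
    | succ j ih =>
      by_cases hne : (F (S j)).Nonempty
      · exact (hgo j hne).1 ▸ hpush _ ih _ (σ.pick_mem j _ hne)
      · exact (hidle j hne).1 ▸ ih
  have hiter : ∀ j, mass (S (j + 1)) + α * δ / 2 * iterTime α G F σ st j ≤ mass (S j) := by
    intro j
    by_cases hne : (F (S j)).Nonempty
    · have hu := hF _ (hSP j) _ (σ.pick_mem j _ hne)
      have hm := mass_push_add_le (st := S j) hα1 hu.1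
      rw [(hgo j hne).1, (hgo j hne).2]
      have h3 : (1 : ℝ) ≤ G.degree (σ.pick j (F (S j))) := by
        exact_mod_cast Nat.one_le_iff_ne_zero.2 hu.1
      have h4 := mul_le_mul_of_nonneg_left hu.2 hα.le
      have h5 := mul_le_mul_of_nonneg_left h3 (mul_pos hα hδ).le
      push_cast
      linarith
    · simp [hidle j hne]
  have hsum : ∀ N, mass (S N) + α * δ / 2 * (∑ j ∈ Finset.range N, iterTime α G F σ st j : ℕ) ≤
      mass st := by
    intro N
    induction N with
    | zero => simp [hS, loopState]
    | succ N ih =>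
      rw [Finset.sum_range_succ]
      push_cast at ih ⊢
      linarith [hiter N]
  have hbound : ∀ N, ((∑ j ∈ Finset.range N, iterTime α G F σ st j : ℕ) : ℝ) ≤
      2 * mass st / (α * δ) := by
    intro N
    rw [le_div_iff₀ (mul_pos hα hδ)]
    linarith [hsum N, mass_nonneg (S N)]
  have hempty : ∃ N, F (S N) = ∅ := by
    by_contra! hne
    obtain ⟨N, hN⟩ := exists_nat_gt (2 * mass st / (α * δ))
    have hle : N ≤ ∑ j ∈ Finset.range N, iterTime α G F σ st j := by
      have : ∑ _j ∈ Finset.range N, 1 ≤ ∑ j ∈ Finset.range N, iterTime α G F σ st j := by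
        refine Finset.sum_le_sum fun j _ => ?_
        rw [(hgo j (hne j)).2]
        exact Nat.le_add_right _ _
      simpa using this
    have hle' : (N : ℝ) ≤ (∑ j ∈ Finset.range N, iterTime α G F σ st j : ℕ) :=
      Nat.cast_le.2 hle
    linarith [hbound N]
  have hval : (pushLoop α G F σ st).val = S (Nat.find hempty) := by
    simp only [pushLoop]
    rw [dif_pos hempty]
  refine ⟨hval ▸ hSP _, hval ▸ Nat.find_spec hempty, ?_, (TimeLE.natCast _).add (.iSup hbound)⟩
  rw [hval]
  have := hsum (Nat.find hempty)
  have h0 : 0 ≤ α * δ / 2 * (∑ j ∈ Finset.range (Nat.find hempty), iterTime α G F σ st j : ℕ) := by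
    positivity
  linarith

/-- Residuals vanish off the graph, so filling the queue takes at most one step per node. -/
lemma Balanced.card_residual_le (h : Balanced α G s st) (hα : 0 < α) (hs : G.degree s ≠ 0) :
    (Finset.univ.filter fun u => st.r u ≠ 0).card ≤ G.support.toFinset.card := by
  refine Finset.card_le_card fun x hx => ?_
  rw [Finset.mem_filter] at hx
  rw [Set.mem_toFinset, SimpleGraph.mem_support, ← G.degree_pos_iff_exists_adj x]
  exact Nat.pos_of_ne_zero fun h0 => hx.2 (h.residual_isolated hα hs h0)

lemma forwardPush_spec (h : Balanced α G s st) (hα : 0 < α) (hα1 : α ≤ 1) (hδ : 0 < δ)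
    (hs : G.degree s ≠ 0) (σpos σneg : Scheduler V) :
    Balanced α G s (forwardPush α G δ σpos σneg st).val ∧
    (∀ x, |(forwardPush α G δ σpos σneg st).val.r x| ≤ δ * G.degree x) ∧
    TimeLE (forwardPush α G δ σpos σneg st).time
      (2 * (G.support.toFinset.card : ℝ) + 2 + 4 * mass st / (α * δ)) := by
  have hnonneg : ∀ x, 0 ≤ δ * (G.degree x : ℝ) := fun x => by positivity
  have hFpos : ∀ st, Balanced α G s st → ∀ u ∈ posFrontier G δ st,
      G.degree u ≠ 0 ∧ δ * G.degree u ≤ |st.r u| := by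
    intro st hst u hu
    have hu' : δ * G.degree u < st.r u := (Finset.mem_filter.1 hu).2
    refine ⟨fun h0 => ?_, hu'.le.trans (le_abs_self _)⟩
    exact (hnonneg u).not_gt (hst.residual_isolated hα hs h0 ▸ hu')
  have hFneg : ∀ st, Balanced α G s st → ∀ u ∈ negFrontier G δ st,
      G.degree u ≠ 0 ∧ δ * G.degree u ≤ |st.r u| := by
    intro st hst u hu
    have hu' : st.r u < -(δ * G.degree u) := (Finset.mem_filter.1 hu).2
    refine ⟨fun h0 => ?_, by linarith [neg_abs_le (st.r u)]⟩
    have := hst.residual_isolated hα hs h0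
    linarith [hnonneg u]
  obtain ⟨hb1, hempty1, hmass1, htime1⟩ := pushLoop_spec hα hα1 hδ (posFrontier G δ) σpos
    (Balanced α G s) h hFpos (fun st hst u hu => hst.push (hFpos st hst u hu).1)
  set first := pushLoop α G (posFrontier G δ) σpos st with hfirst
  have hle1 : ∀ x, first.val.r x ≤ δ * G.degree x := by
    intro x
    by_contra! hx
    have : x ∈ posFrontier G δ first.val := Finset.mem_filter.2 ⟨Finset.mem_univ x, hx⟩
    simp [hempty1] at this
  -- A push of a negative residual only lowers the other residuals, which keeps the upper bounds.
  obtain ⟨⟨hb2, hle2⟩, hempty2, -, htime2⟩ := pushLoop_spec hα hα1 hδ (negFrontier G δ) σneg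
    (fun st => Balanced α G s st ∧ ∀ x, st.r x ≤ δ * G.degree x) ⟨hb1, hle1⟩
    (fun st hst => hFneg st hst.1) (by
      rintro st ⟨hst, hle⟩ u hu
      refine ⟨hst.push (hFneg st hst u hu).1, fun x => ?_⟩
      have hu' : st.r u < -(δ * G.degree u) := (Finset.mem_filter.1 hu).2
      have hru : st.r u ≤ 0 := by linarith [hnonneg u]
      have : (1 - α) * st.r u / G.degree u ≤ 0 :=
        div_nonpos_of_nonpos_of_nonneg
          (mul_nonpos_of_nonneg_of_nonpos (sub_nonneg.2 hα1) hru) (Nat.cast_nonneg _)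
      simp only [push]
      split_ifs
      · exact hnonneg x
      · linarith [hle x]
      · exact hle x)
  set second := pushLoop α G (negFrontier G δ) σneg first.val with hsecond
  have hval : (forwardPush α G δ σpos σneg st).val = second.val := rfl
  have htime : (forwardPush α G δ σpos σneg st).time = first.time + second.time := rfl
  rw [hval, htime]
  refine ⟨hb2, fun x => abs_le.2 ⟨?_, hle2 x⟩, (htime1.add htime2).mono ?_⟩
  · by_contra! hx
    have : x ∈ negFrontier G δ second.val := Finset.mem_filter.2 ⟨Finset.mem_univ x, hx⟩
    simp [hempty2] at this
  · have h1 : (((Finset.univ.filter fun u => st.r u ≠ 0).card : ℕ) : ℝ) ≤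
        G.support.toFinset.card := Nat.cast_le.2 (h.card_residual_le hα hs)
    have h2 : (((Finset.univ.filter fun u => first.val.r u ≠ 0).card : ℕ) : ℝ) ≤
        G.support.toFinset.card := Nat.cast_le.2 (hb1.card_residual_le hα hs)
    have h3 : 2 * mass first.val / (α * δ) ≤ 2 * mass st / (α * δ) := by gcongr
    push_cast
    have h4 : 4 * mass st / (α * δ) = 2 * mass st / (α * δ) + 2 * mass st / (α * δ) := by ring
    linarith

end Loops

/-! ### Batches and `DynamicSNE` -/

section Batches

variable {V : Type*} [Fintype V] {α δ : ℝ} {s : V}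

/-- The sum of `|p(u)| / d(u)` over the ends of the edges of a batch. It bounds the residual that
the batch creates. -/
noncomputable def batchLoad (G : SimpleGraph V) (p : V → ℝ) (es : List (EdgeEvent V)) : ℝ :=
  (es.map fun e => |perDegree G p e.u| + |perDegree G p e.v|).sum

lemma processBatch_spec (hα : 0 < α) (hα1 : α ≤ 1) (es : List (EdgeEvent V)) :
    ∀ (G : SimpleGraph V) (st : PushState V), Balanced α G s st → ValidBatch G es →
      Balanced α (applyBatch G es) s (processBatch α G es st).val ∧
      mass (processBatch α G es st).val ≤ mass st + 2 / α * batchLoad G st.p es ∧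
      (processBatch α G es st).time = (2 * es.length : ℕ) := by
  induction es with
  | nil =>
    intro G st h _
    exact ⟨h, by simp [processBatch, batchLoad], by simp [processBatch]⟩
  | cons e es ih =>
    intro G st h hv
    obtain ⟨hb, hq, hm⟩ := h.update hα hα1 hv.1
    obtain ⟨ihb, ihm, iht⟩ := ih (e.apply G) (e.update α G st) hb hv.2
    have hval : (processBatch α G (e :: es) st).val =
      (processBatch α (e.apply G) es (e.update α G st)).val := rfl
    have htime : (processBatch α G (e :: es) st).time =
      2 + (processBatch α (e.apply G) es (e.update α G st)).time := rfl
    refine ⟨ihb, ?_, ?_⟩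
    · have hload : batchLoad (e.apply G) (e.update α G st).p es ≤ batchLoad G st.p es :=
        List.sum_le_sum fun e' _ => add_le_add (hq _) (hq _)
      have hload' := mul_le_mul_of_nonneg_left hload (show 0 ≤ 2 / α by positivity)
      have hcons : batchLoad G st.p (e :: es) =
        |perDegree G st.p e.u| + |perDegree G st.p e.v| + batchLoad G st.p es := by
        simp [batchLoad]
      rw [hval, hcons]
      linarith
    · rw [htime, iht, List.length_cons]
      push_cast
      ring

lemma dynamicSNE_spec {dim : ℕ} (hα : 0 < α) (hα1 : α ≤ 1) (hδ : 0 < δ) (hd : V → Fin dim)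
    (hsgn : V → ℤˣ) {G : SimpleGraph V} {es : List (EdgeEvent V)} (hv : ValidBatch G es)
    {st : PushState V} (h : Balanced α G s st) (σpos σneg : Scheduler V)
    {G' : SimpleGraph V} (hG' : applyBatch G es = G') (hs : G'.degree s ≠ 0) :
    Balanced α G' s (dynamicSNE α hd hsgn G es δ σpos σneg st).val.1 ∧
    (∀ x, |(dynamicSNE α hd hsgn G es δ σpos σneg st).val.1.r x| ≤ δ * G'.degree x) ∧
    TimeLE (dynamicSNE α hd hsgn G es δ σpos σneg st).time
      (2 * (es.length : ℝ) + (3 * (G'.support.toFinset.card : ℝ) + 2 +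
        4 * (mass st + 2 / α * batchLoad G st.p es) / (α * δ))) := by
  obtain ⟨hb, hm, ht⟩ := processBatch_spec hα hα1 es G st h hv
  rw [hG'] at hb
  obtain ⟨hb', hr, ht'⟩ := forwardPush_spec hb hα hα1 hδ hs σpos σneg
  subst hG'
  set a := processBatch α G es st with ha
  set b := forwardPush α (applyBatch G es) δ σpos σneg a.val with hb_def
  set c := project hd hsgn (applyBatch G es) b.val.p with hc
  have hval : (dynamicSNE α hd hsgn G es δ σpos σneg st).val.1 = b.val := rfl
  have htime : (dynamicSNE α hd hsgn G es δ σpos σneg st).time = a.time + b.time + c.time := rfl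
  rw [hval, htime]
  refine ⟨hb', hr, ((((ht ▸ TimeLE.natCast _).add ht').add (TimeLE.natCast _)).mono ?_)⟩
  have h1 : ((((applyBatch G es).support.toFinset.filter fun x => b.val.p x ≠ 0).card : ℕ) : ℝ) ≤
      (applyBatch G es).support.toFinset.card :=
    Nat.cast_le.2 (Finset.card_filter_le _ _)
  have h2 : 4 * mass a.val / (α * δ) ≤
      4 * (mass st + 2 / α * batchLoad G st.p es) / (α * δ) := by gcongr
  push_cast
  linarith

end Batches

/-! ### The estimates summed over the target nodes -/

section MaximumPrinciple

variable {V : Type*} [Fintype V] {α δ : ℝ} {G : SimpleGraph V}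

/-- By the invariant, `p(x) / d(x)` is `1 - α` times its mean over the neighbours of `x`, up to an
error of `α (1_s(x) / d(x) + δ)`. Summed over the target nodes `s`, the errors are at most
`α (1 + |A| δ)`, and the bound follows at a node where the sum is maximal. -/
lemma sum_abs_perDegree_le (hα : 0 < α) (hα1 : α ≤ 1) (hδ : 0 ≤ δ) {A : Finset V}
    {st : V → PushState V} (h : ∀ s ∈ A, Balanced α G s (st s))
    (hr : ∀ s ∈ A, ∀ x, |(st s).r x| ≤ δ * G.degree x) (x : V) :
    ∑ s ∈ A, |perDegree G (st s).p x| ≤ 1 + A.card * δ := by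
  set Q : V → ℝ := fun x => ∑ s ∈ A, |perDegree G (st s).p x| with hQ
  have : Nonempty V := ⟨x⟩
  obtain ⟨y, hy⟩ := Finite.exists_max Q
  refine (hy x).trans ?_
  by_cases hdy : G.degree y = 0
  · have : Q y = 0 := by simp [hQ, perDegree, hdy]
    rw [this]
    positivity
  have hd : (1 : ℝ) ≤ G.degree y := by exact_mod_cast Nat.one_le_iff_ne_zero.2 hdy
  have hd0 : (0 : ℝ) < G.degree y := by linarith
  have hpt : ∀ s ∈ A, G.degree y * |perDegree G (st s).p y| ≤
      (1 - α) * ∑ w ∈ G.neighborFinset y, |perDegree G (st s).p w| +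
        ((if s = y then α else 0) + α * (δ * G.degree y)) := by
    intro s hs
    have hb := (h s hs).balance y
    have h1 : G.degree y * |perDegree G (st s).p y| = |(st s).p y| := by
      rw [perDegree, abs_div, abs_of_pos hd0, mul_div_cancel₀ _ hd0.ne']
    have h2 : (st s).p y = (1 - α) * ∑ w ∈ G.neighborFinset y, perDegree G (st s).p w +
        ((if s = y then α else 0) + -(α * (st s).r y)) := by
      rw [show (if s = y then α else 0) = if y = s then α else 0 by simp only [eq_comm]]
      linarith
    rw [h1, h2]
    refine (abs_add_le _ _).trans (add_le_add ?_ ((abs_add_le _ _).trans (add_le_add ?_ ?_)))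
    · rw [abs_mul, abs_of_nonneg (sub_nonneg.2 hα1)]
      exact mul_le_mul_of_nonneg_left (Finset.abs_sum_le_sum_abs _ _) (sub_nonneg.2 hα1)
    · split_ifs
      · exact (abs_of_pos hα).le
      · simp
    · rw [abs_neg, abs_mul, abs_of_pos hα]
      exact mul_le_mul_of_nonneg_left (hr s hs y) hα.le
  have hsum := Finset.sum_le_sum hpt
  have hind : ∑ s ∈ A, (if s = y then α else 0) ≤ α := by
    rw [Finset.sum_ite_eq']
    split_ifs <;> linarith
  have hnbr : ∑ w ∈ G.neighborFinset y, Q w ≤ G.degree y * Q y := by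
    rw [← SimpleGraph.card_neighborFinset_eq_degree, ← nsmul_eq_mul]
    exact Finset.sum_le_card_nsmul _ _ _ fun w _ => hy w
  have hnbr' := mul_le_mul_of_nonneg_left hnbr (sub_nonneg.2 hα1)
  rw [← Finset.mul_sum, Finset.sum_add_distrib, Finset.sum_add_distrib, ← Finset.mul_sum,
    Finset.sum_comm, Finset.sum_const, nsmul_eq_mul] at hsum
  have hmul : (α * G.degree y) * Q y ≤ (α * G.degree y) * (1 + A.card * δ) := by
    have := mul_le_mul_of_nonneg_left hd hα.le
    linarith
  exact le_of_mul_le_mul_left hmul (mul_pos hα hd0)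

end MaximumPrinciple

/-! ### Snapshots -/

namespace DynamicGraph

variable {V : Type*} [Fintype V] (D : DynamicGraph V) {ε : ℝ}

lemma sum_degree (t : ℕ) : ∑ x, ((D.snapshot t).degree x : ℝ) = 2 * D.numEdges t := by
  have := (D.snapshot t).sum_degrees_eq_twice_card_edges
  unfold numEdges
  exact_mod_cast this

lemma mem_nodes {t : ℕ} {x : V} : x ∈ D.nodes t ↔ (D.snapshot t).degree x ≠ 0 := by
  rw [nodes, Set.mem_toFinset, SimpleGraph.mem_support, ← Nat.pos_iff_ne_zero,
    SimpleGraph.degree_pos_iff_exists_adj]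

lemma numNodes_le (t : ℕ) : (D.numNodes t : ℝ) ≤ 2 * D.numEdges t := by
  rw [← D.sum_degree t, numNodes, Finset.card_eq_sum_ones]
  push_cast
  calc ∑ _x ∈ D.nodes t, (1 : ℝ) ≤ ∑ x ∈ D.nodes t, ((D.snapshot t).degree x : ℝ) :=
        Finset.sum_le_sum fun x hx => by
          exact_mod_cast Nat.one_le_iff_ne_zero.2 (D.mem_nodes.1 hx)
    _ ≤ _ := Finset.sum_le_sum_of_subset_of_nonneg (Finset.subset_univ _)
        fun _ _ _ => Nat.cast_nonneg _

lemma one_le_numEdges {t : ℕ} (h : (D.nodes t).Nonempty) : (1 : ℝ) ≤ D.numEdges t := by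
  have h1 := D.numNodes_le t
  have h2 : (1 : ℝ) ≤ D.numNodes t := by exact_mod_cast h.card_pos
  have h3 : (0 : ℝ) < D.numEdges t := by linarith
  exact_mod_cast h3

end DynamicGraph

section Precision

variable {V : Type*} [Fintype V] (D : DynamicGraph V) {ε : ℝ}

lemma precision_nonneg (hε : 0 < ε) (t : ℕ) : 0 ≤ precision D ε t := by
  cases t <;> simp only [precision] <;> positivity

lemma precision_pos (hε : 0 < ε) {t : ℕ} (h : (D.nodes t).Nonempty) : 0 < precision D ε t := by
  have := D.one_le_numEdges h
  cases t <;> simp only [precision] <;> positivity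

lemma numEdges_mul_precision_le (hε2 : ε ≤ 2) (t : ℕ) : D.numEdges t * precision D ε t ≤ 2 := by
  rcases eq_or_ne (D.numEdges t : ℝ) 0 with h | h
  · simp [h]
  · cases t <;> simp only [precision]
    · rw [mul_one_div_cancel h]
      norm_num
    · rwa [mul_div_cancel₀ _ h]

lemma mass_le_four (hε2 : ε ≤ 2) {t : ℕ} {st : PushState V}
    (hr : ∀ x, |st.r x| ≤ precision D ε t * (D.snapshot t).degree x) : mass st ≤ 4 := by
  have h := Finset.sum_le_sum fun x (_ : x ∈ Finset.univ) => hr x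
  rw [← Finset.mul_sum, D.sum_degree] at h
  have := numEdges_mul_precision_le D hε2 t
  unfold mass
  linarith

end Precision

/-! ### One target node -/

section Target

variable {V : Type*} [Fintype V] {dim : ℕ} (D : DynamicGraph V) {α ε : ℝ} (hd : V → Fin dim)
  (hsgn : V → ℤˣ) (σpos σneg : ℕ → V → Scheduler V)

/-- What a snapshot leaves behind for a target node `s` that has appeared. -/
structure Settled (α ε : ℝ) (t : ℕ) (s : V) (st : PushState V) : Prop where
  mem_nodes : s ∈ D.nodes t
  balanced : Balanced α (D.snapshot t) s st
  residual_le : ∀ x, |st.r x| ≤ precision D ε t * (D.snapshot t).degree x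

/-- The load of the batch that follows snapshot `t` on the estimates of the target node `s`, which
is `0` as long as `s` has not appeared. -/
noncomputable def targetLoad (α ε : ℝ) (t : ℕ) (s : V) : ℝ :=
  match (targetStep D α ε hd hsgn σpos σneg s t).val with
  | some (st, _) => batchLoad (D.snapshot t) st.p (D.batch t)
  | none => 0

/-- The bound for the time spent on the target node `s` at snapshot `t`. The step that looks for `s`
in the initial graph is kept apart, since that graph may be empty. -/
noncomputable def targetBound (α ε : ℝ) (s : V) : ℕ → ℝ
  | 0 => 1 + 34 * (D.numEdges 0 / (ε * α))
  | t + 1 => 3 * D.numEvents (t + 1) + 34 * (D.numEdges (t + 1) / (ε * α)) +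
      8 / α * targetLoad D hd hsgn σpos σneg α ε t s * (D.numEdges (t + 1) / (ε * α))

variable {D}

lemma numEdges_le_two_mul (hα : 0 < α) (hα1 : α ≤ 1) (hε : 0 < ε) (hε2 : ε ≤ 2) (t : ℕ) :
    (D.numEdges t : ℝ) ≤ 2 * (D.numEdges t / (ε * α)) := by
  have h : ε * α ≤ 2 := by nlinarith
  rw [← mul_div_assoc, le_div_iff₀ (mul_pos hε hα)]
  nlinarith [(Nat.cast_nonneg (D.numEdges t) : (0 : ℝ) ≤ _)]

/-- The cost of a run after its batch: the queues and the projection take at most `3 n` steps, and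
`n ≤ 2 m ≤ 4 m / (ε α)`. -/
lemma run_cost_le (hα : 0 < α) (hα1 : α ≤ 1) (hε : 0 < ε) (hε2 : ε ≤ 2) {t : ℕ}
    (hne : (D.nodes t).Nonempty) {δ μ L : ℝ}
    (hδ : 4 * μ / (α * δ) ≤ 16 * (D.numEdges t / (ε * α)) +
      8 / α * L * (D.numEdges t / (ε * α))) :
    1 + (3 * (D.numNodes t : ℝ) + 2 + 4 * μ / (α * δ)) ≤
      34 * (D.numEdges t / (ε * α)) + 8 / α * L * (D.numEdges t / (ε * α)) := by
  have h1 := numEdges_le_two_mul (D := D) hα hα1 hε hε2 t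
  have h2 := D.numNodes_le t
  have h3 := D.one_le_numEdges hne
  linarith

/-- By induction on the snapshots: the residual that snapshot `t` leaves behind is at most `4`, so
snapshot `t + 1` pays a constant times `m / (ε α)` for it, and besides only for its batch. -/
lemma targetStep_spec (hα : 0 < α) (hα1 : α ≤ 1) (hε : 0 < ε) (hε2 : ε ≤ 2) {T : ℕ}
    (hv : ∀ t < T, ValidBatch (D.snapshot t) (D.batch t))
    (hmono : ∀ t < T, D.nodes t ⊆ D.nodes (t + 1)) (s : V) (t : ℕ) (ht : t ≤ T) :
    (∀ c, (targetStep D α ε hd hsgn σpos σneg s t).val = some c → Settled D α ε t s c.1) ∧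
    TimeLE (targetStep D α ε hd hsgn σpos σneg s t).time
      (targetBound D hd hsgn σpos σneg α ε s t) := by
  induction t with
  | zero =>
    have hX : 0 ≤ D.numEdges 0 / (ε * α) := by positivity
    by_cases hs : s ∈ D.nodes 0
    · have hne : (D.nodes 0).Nonempty := ⟨s, hs⟩
      have hm := D.one_le_numEdges hne
      obtain ⟨hb, hr, htime⟩ := dynamicSNE_spec hα hα1 (precision_pos D hε hne) hd hsgn
        (G := D.snapshot 0) (es := []) trivial (balanced_start α _ s) (σpos 0 s) (σneg 0 s)
        (show applyBatch (D.snapshot 0) [] = D.snapshot 0 from rfl) (D.mem_nodes.1 hs)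
      simp only [targetStep, if_pos hs]
      refine ⟨?_, ?_⟩
      · rintro _ ⟨⟩
        exact ⟨hs, hb, hr⟩
      · refine ((TimeLE.natCast 1).add htime).mono ?_
        have hcost := run_cost_le hα hα1 hε hε2 hne (δ := precision D ε 0) (μ := 1) (L := 0) (by
          have : 4 * 1 / (α * precision D ε 0) = 4 * ε * (D.numEdges 0 / (ε * α)) := by
            simp only [precision]
            field_simp
          rw [this]
          nlinarith)
        have hn : (D.snapshot 0).support.toFinset.card = D.numNodes 0 := rfl
        simp only [mass_start, batchLoad, targetBound, List.map_nil,
          List.sum_nil, List.length_nil, hn, mul_zero, zero_mul, add_zero, zero_add,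
          Nat.cast_zero, Nat.cast_one] at hcost ⊢
        linarith
    · simp only [targetStep, if_neg hs]
      refine ⟨by simp, (TimeLE.natCast 1).mono ?_⟩
      simp only [targetBound, Nat.cast_one]
      linarith
  | succ t ih =>
    have hlt : t < T := ht
    obtain ⟨ih, -⟩ := ih hlt.le
    have hX : 0 ≤ D.numEdges (t + 1) / (ε * α) := by positivity
    have hM : (0 : ℝ) ≤ D.numEvents (t + 1) := Nat.cast_nonneg _
    have hinv : (D.nodes (t + 1)).Nonempty →
        ∀ μ : ℝ, 4 * μ / (α * precision D ε (t + 1)) =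
          4 * μ * (D.numEdges (t + 1) / (ε * α)) := by
      intro hne μ
      have hm := D.one_le_numEdges hne
      simp only [precision]
      field_simp
    have hn : (D.snapshot (t + 1)).support.toFinset.card = D.numNodes (t + 1) := rfl
    rcases hval : (targetStep D α ε hd hsgn σpos σneg s t).val with _ | ⟨st, w⟩
    · have hL : targetLoad D hd hsgn σpos σneg α ε t s = 0 := by simp [targetLoad, hval]
      by_cases hs : s ∈ D.nodes (t + 1)
      · have hne : (D.nodes (t + 1)).Nonempty := ⟨s, hs⟩
        obtain ⟨hb, hr, htime⟩ := dynamicSNE_spec hα hα1 (precision_pos D hε hne) hd hsgn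
          (G := D.snapshot (t + 1)) (es := []) trivial (balanced_start α _ s) (σpos (t + 1) s)
          (σneg (t + 1) s)
          (show applyBatch (D.snapshot (t + 1)) [] = D.snapshot (t + 1) from rfl)
          (D.mem_nodes.1 hs)
        simp only [targetStep, hval, if_pos hs]
        refine ⟨?_, ?_⟩
        · rintro _ ⟨⟩
          exact ⟨hs, hb, hr⟩
        · refine (((TimeLE.natCast _).add (TimeLE.natCast 1)).add htime).mono ?_
          have hcost := run_cost_le hα hα1 hε hε2 hne (δ := precision D ε (t + 1)) (μ := 1)
            (L := 0) (by rw [hinv hne]; linarith)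
          simp only [mass_start, batchLoad, targetBound, List.map_nil, List.sum_nil,
            List.length_nil, hn, hL, mul_zero, zero_mul, add_zero, zero_add, Nat.cast_zero,
            Nat.cast_one] at hcost ⊢
          linarith
      · simp only [targetStep, hval, if_neg hs]
        refine ⟨by simp, (TimeLE.natCast _).mono ?_⟩
        simp only [targetBound, hL]
        linarith
    · have hset := ih _ hval
      have hs : s ∈ D.nodes (t + 1) := hmono t hlt hset.mem_nodes
      have hne : (D.nodes (t + 1)).Nonempty := ⟨s, hs⟩
      have hL : targetLoad D hd hsgn σpos σneg α ε t s =
          batchLoad (D.snapshot t) st.p (D.batch t) := by simp [targetLoad, hval]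
      obtain ⟨hb, hr, htime⟩ := dynamicSNE_spec hα hα1 (precision_pos D hε hne) hd hsgn
        (hv t hlt) hset.balanced (σpos (t + 1) s) (σneg (t + 1) s)
        (show applyBatch (D.snapshot t) (D.batch t) = D.snapshot (t + 1) from rfl)
        (D.mem_nodes.1 hs)
      simp only [targetStep, hval]
      refine ⟨?_, ?_⟩
      · rintro _ ⟨⟩
        exact ⟨hs, hb, hr⟩
      · refine htime.mono ?_
        have hmass := mul_le_mul_of_nonneg_right (mass_le_four D hε2 hset.residual_le) hX
        have hcost := run_cost_le hα hα1 hε hε2 hne (δ := precision D ε (t + 1))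
          (μ := mass st + 2 / α * batchLoad (D.snapshot t) st.p (D.batch t))
          (L := batchLoad (D.snapshot t) st.p (D.batch t)) (by
            rw [hinv hne, show ∀ a b c d : ℝ, 4 * (a + 2 / b * c) * d =
              4 * (a * d) + 8 / b * c * d by intros; ring]
            linarith)
        have hlen : ((D.batch t).length : ℝ) = D.numEvents (t + 1) := rfl
        simp only [targetBound, hL, hn, hlen]
        linarith

end Target

/-! ### All target nodes -/

section Average

variable {V : Type*} [Fintype V] {dim : ℕ} {D : DynamicGraph V} {α ε : ℝ} (hd : V → Fin dim)
  (hsgn : V → ℤˣ) (σpos σneg : ℕ → V → Scheduler V)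

/-- Summed over any set of target nodes, every event has load at most `10`, that is `5` for each
end of its edge. -/
lemma sum_targetLoad_le (hα : 0 < α) (hα1 : α ≤ 1) (hε : 0 < ε) (hε2 : ε ≤ 2) {T : ℕ}
    (hv : ∀ t < T, ValidBatch (D.snapshot t) (D.batch t))
    (hmono : ∀ t < T, D.nodes t ⊆ D.nodes (t + 1)) {t : ℕ} (ht : t < T) (A : Finset V) :
    ∑ s ∈ A, targetLoad D hd hsgn σpos σneg α ε t s ≤ 10 * D.numEvents (t + 1) := by
  set out : V → Option (PushState V × (Fin dim → ℝ)) :=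
    fun s => (targetStep D α ε hd hsgn σpos σneg s t).val with hout
  set st : V → PushState V := fun s => ((out s).map Prod.fst).getD (PushState.start s) with hst
  set B := A.filter fun s => (out s).isSome with hB
  have hspec : ∀ s ∈ B, Settled D α ε t s (st s) := by
    intro s hs
    obtain ⟨c, hc⟩ := Option.isSome_iff_exists.1 (Finset.mem_filter.1 hs).2
    have : st s = c.1 := by simp [hst, hc]
    rw [this]
    exact (targetStep_spec hd hsgn σpos σneg hα hα1 hε hε2 hv hmono s t ht.le).1 c hc
  have hload : ∑ s ∈ A, targetLoad D hd hsgn σpos σneg α ε t s =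
      ∑ s ∈ B, batchLoad (D.snapshot t) (st s).p (D.batch t) := by
    rw [hB, Finset.sum_filter]
    refine Finset.sum_congr rfl fun s _ => ?_
    rcases hc : (targetStep D α ε hd hsgn σpos σneg s t).val with _ | ⟨st', w⟩
    · simp [targetLoad, hout, hc]
    · simp [targetLoad, hout, hst, hc]
  have hcard : (B.card : ℝ) ≤ D.numNodes t :=
    Nat.cast_le.2 (Finset.card_le_card fun s hs => (hspec s hs).mem_nodes)
  have hQ : ∀ x, ∑ s ∈ B, |perDegree (D.snapshot t) (st s).p x| ≤ 5 := by
    intro x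
    have h1 := sum_abs_perDegree_le hα hα1 (precision_nonneg D hε t)
      (fun s hs => (hspec s hs).balanced) (fun s hs => (hspec s hs).residual_le) x
    have h2 := mul_le_mul_of_nonneg_right (hcard.trans (D.numNodes_le t))
      (precision_nonneg D hε t)
    have h3 := numEdges_mul_precision_le D hε2 t
    linarith
  have hlist : ∀ es : List (EdgeEvent V),
      ∑ s ∈ B, batchLoad (D.snapshot t) (st s).p es ≤ 10 * es.length := by
    intro es
    induction es with
    | nil => simp [batchLoad]
    | cons e es ih =>
      have : ∀ s, batchLoad (D.snapshot t) (st s).p (e :: es) =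
          (|perDegree (D.snapshot t) (st s).p e.u| + |perDegree (D.snapshot t) (st s).p e.v|) +
            batchLoad (D.snapshot t) (st s).p es := fun s => by simp [batchLoad]
      simp only [this, Finset.sum_add_distrib, List.length_cons]
      push_cast
      linarith [hQ e.u, hQ e.v]
  rw [hload]
  exact hlist (D.batch t)

/-- A uniformly random `k`-subset contains each element with probability `k / |A|`. -/
lemma card_mul_sum_powersetCard {ι : Type*} (A : Finset ι) {k : ℕ} (hk : 1 ≤ k)
    (hkA : k ≤ A.card) (b : ι → ℝ) :
    A.card * ∑ S ∈ A.powersetCard k, ∑ s ∈ S, b s =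
      k * A.card.choose k * ∑ s ∈ A, b s := by
  have hcount : ∀ s ∈ A, ((A.powersetCard k).filter fun S => s ∈ S).card =
      (A.card - 1).choose (k - 1) := by
    intro s hs
    have := Finset.card_filter_powersetCard_subset {s} A k (by simpa using hs) (by simpa using hk)
    simpa using this
  have hswap : ∑ S ∈ A.powersetCard k, ∑ s ∈ S, b s =
      ∑ s ∈ A, ∑ _S ∈ (A.powersetCard k).filter (fun S => s ∈ S), b s := by
    refine Finset.sum_comm' fun S s => ?_
    rw [Finset.mem_filter]
    constructor
    · rintro ⟨h1, h2⟩
      exact ⟨⟨h1, h2⟩, (Finset.mem_powersetCard.1 h1).1 h2⟩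
    · rintro ⟨h, -⟩
      exact h
  have hchoose : (A.card : ℝ) * (A.card - 1).choose (k - 1) = k * A.card.choose k := by
    obtain ⟨j, rfl⟩ := Nat.exists_eq_add_of_le' hk
    obtain ⟨a, ha⟩ := Nat.exists_eq_add_of_le' (hk.trans hkA)
    rw [ha]
    have := Nat.add_one_mul_choose_eq a j
    rw [mul_comm ((j + 1 : ℕ) : ℝ)]
    exact_mod_cast this
  rw [hswap, ← hchoose, mul_assoc, Finset.mul_sum _ _ ((A.card - 1).choose (k - 1) : ℝ)]
  congr 1
  refine Finset.sum_congr rfl fun s hs => ?_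
  rw [Finset.sum_const, hcount s hs, nsmul_eq_mul]

lemma nodes_subset {T : ℕ} (hmono : ∀ t < T, D.nodes t ⊆ D.nodes (t + 1)) {t : ℕ} (ht : t ≤ T) :
    D.nodes t ⊆ D.nodes T := by
  induction T, ht using Nat.le_induction with
  | base => exact subset_rfl
  | succ T hT ih =>
    exact (ih fun t ht => hmono t (ht.trans T.lt_succ_self)).trans (hmono T T.lt_succ_self)

/-- The bound on the expected time: summed over the `n_T` possible target nodes, the loads of the
events cost as much as `n_T` times the average degree. -/
lemma sum_targetBound_le (hα : 0 < α) (hα1 : α ≤ 1) (hε : 0 < ε) (hε2 : ε ≤ 2) {T : ℕ}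
    (hv : ∀ t < T, ValidBatch (D.snapshot t) (D.batch t))
    (hmono : ∀ t < T, D.nodes t ⊆ D.nodes (t + 1)) {t : ℕ} (ht : t ≤ T) :
    ∑ s ∈ D.nodes T, targetBound D hd hsgn σpos σneg α ε s t ≤
      D.numNodes T * ((if t = 0 then 1 else 0) + 3 * D.numEvents t +
        34 * (D.numEdges t / (ε * α)) + 40 * (D.numEvents t * D.avgDegree t / (ε * α ^ 2))) := by
  have hN : ((D.nodes T).card : ℝ) = D.numNodes T := rfl
  cases t with
  | zero => simp [targetBound, DynamicGraph.numEvents, hN, mul_add]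
  | succ t =>
    have hload := sum_targetLoad_le hd hsgn σpos σneg hα hα1 hε hε2 hv hmono ht (D.nodes T)
    -- The mean is over the `n_T ≥ n_t` nodes of the last snapshot.
    have hdeg : 2 * (D.numEdges (t + 1) : ℝ) ≤ D.numNodes T * D.avgDegree (t + 1) := by
      have hle : (D.numNodes (t + 1) : ℝ) ≤ D.numNodes T :=
        Nat.cast_le.2 (Finset.card_le_card (nodes_subset hmono ht))
      have havg : 0 ≤ D.avgDegree (t + 1) := by unfold DynamicGraph.avgDegree; positivity
      refine le_trans (le_of_eq ?_) (mul_le_mul_of_nonneg_right hle havg)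
      rcases Nat.eq_zero_or_pos (D.numNodes (t + 1)) with h0 | h0
      · have hsum := D.sum_degree (t + 1)
        have hempty : D.nodes (t + 1) = ∅ := Finset.card_eq_zero.1 h0
        have : ∀ x, (D.snapshot (t + 1)).degree x = 0 := by
          intro x
          by_contra hx
          have := D.mem_nodes.2 hx
          simp [hempty] at this
        simp only [this, Nat.cast_zero, Finset.sum_const_zero] at hsum
        rw [← hsum, h0]
        simp
      · have h0' : (D.numNodes (t + 1) : ℝ) ≠ 0 := by positivity
        rw [DynamicGraph.avgDegree, mul_div_cancel₀ _ h0']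
    have h1 : 8 / α * (∑ s ∈ D.nodes T, targetLoad D hd hsgn σpos σneg α ε t s) *
        (D.numEdges (t + 1) / (ε * α)) ≤
        8 / α * (10 * D.numEvents (t + 1)) * (D.numEdges (t + 1) / (ε * α)) := by gcongr
    have h2 : 8 / α * (10 * D.numEvents (t + 1)) * (D.numEdges (t + 1) / (ε * α)) =
        40 * (D.numEvents (t + 1) / (ε * α ^ 2)) * (2 * D.numEdges (t + 1)) := by
      field_simp
      ring
    have h3 : 40 * (D.numEvents (t + 1) / (ε * α ^ 2)) * (2 * (D.numEdges (t + 1) : ℝ)) ≤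
        40 * (D.numEvents (t + 1) / (ε * α ^ 2)) * (D.numNodes T * D.avgDegree (t + 1)) := by
      gcongr
    simp only [targetBound, Finset.sum_add_distrib, Finset.sum_const, nsmul_eq_mul, hN,
      ← Finset.sum_mul, ← Finset.mul_sum]
    rw [if_neg t.succ_ne_zero]
    have h4 : 40 * (D.numEvents (t + 1) / (ε * α ^ 2)) * (D.numNodes T * D.avgDegree (t + 1)) =
        D.numNodes T * (40 * (D.numEvents (t + 1) * D.avgDegree (t + 1) / (ε * α ^ 2))) := by
      ring
    linarith

end Average

end DynPPE

theorem mainTheorem3 :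
    ∃ C : ℝ, 0 < C ∧ ∀ (V : Type*) [Fintype V] (D : DynPPE.DynamicGraph V) (T k dim : ℕ)
      (α ε : ℝ) (hd : V → Fin dim) (hsgn : V → ℤˣ) (σpos σneg : ℕ → V → DynPPE.Scheduler V),
      0 < α → α ≤ 1 → 0 < ε → ε ≤ 2 →
      (∀ t < T, DynPPE.ValidBatch (D.snapshot t) (D.batch t)) →
      (∀ t < T, D.nodes t ⊆ D.nodes (t + 1)) →
      1 ≤ k → k ≤ D.numNodes T →
      (∑ S ∈ (D.nodes T).powersetCard k,
          ((DynPPE.dynamicPPE D T S α ε hd hsgn σpos σneg).time : ℝ≥0∞)) /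
        ((D.numNodes T).choose k : ℝ≥0∞) ≤
      ENNReal.ofReal (C * ∑ t ∈ Finset.range (T + 1),
        ((k : ℝ) * D.numEvents t / α ^ 2 +
          k * D.numEvents t * D.avgDegree t / (ε * α ^ 2) +
          k * D.numEdges t / (ε * α) +
          k * min (D.numNodes t : ℝ) (D.numEdges t / (ε * α)))) := by
  -- `40` is the constant of the terms with the average degree in `sum_targetBound_le`. The terms
  -- `M_t` and `m_t / (ε α)` occur with the smaller constants `4` and `36`.
  refine ⟨40, by norm_num, ?_⟩
  intro V _ D T k dim α ε hd hsgn σpos σneg hα hα1 hε hε2 hv hmono hk hkT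
  set b : ℕ → V → ℝ := fun t s => DynPPE.targetBound D hd hsgn σpos σneg α ε s t
  set R : ℝ := ∑ t ∈ Finset.range (T + 1),
        ((k : ℝ) * D.numEvents t / α ^ 2 +
          k * D.numEvents t * D.avgDegree t / (ε * α ^ 2) +
          k * D.numEdges t / (ε * α) +
          k * min (D.numNodes t : ℝ) (D.numEdges t / (ε * α)))
  have hcard : (D.nodes T).card = D.numNodes T := rfl
  have hk' : (1 : ℝ) ≤ k := by exact_mod_cast hk
  have hN0 : 0 < D.numNodes T := Nat.lt_of_lt_of_le hk hkT
  have hN : (0 : ℝ) < D.numNodes T := Nat.cast_pos.2 hN0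
  have hch : (0 : ℝ) < (D.numNodes T).choose k := Nat.cast_pos.2 (Nat.choose_pos hkT)
  have htime : ∀ S : Finset V, DynPPE.TimeLE (DynPPE.dynamicPPE D T S α ε hd hsgn σpos σneg).time
      (∑ t ∈ Finset.range (T + 1), (D.numEvents t + ∑ s ∈ S, b t s)) := by
    intro S
    simp only [DynPPE.dynamicPPE]
    refine .sum fun t ht => (DynPPE.TimeLE.natCast _).add (.sum fun s _ => ?_)
    exact (DynPPE.targetStep_spec hd hsgn σpos σneg hα hα1 hε hε2 hv hmono s t
      (Nat.lt_succ_iff.1 (Finset.mem_range.1 ht))).2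
  have htotal := DynPPE.TimeLE.sum fun S (_ : S ∈ (D.nodes T).powersetCard k) => htime S
  have hR' : ∑ t ∈ Finset.range (T + 1), ((D.numEvents t : ℝ) +
      k * ((if t = 0 then (1 : ℝ) else 0) + 3 * D.numEvents t +
        34 * (D.numEdges t / (ε * α)) + 40 * (D.numEvents t * D.avgDegree t / (ε * α ^ 2)))) ≤
      40 * R := by
    -- The single step per target at the first snapshot is paid for by the last snapshot, which
    -- has an edge.
    have hfirst : (k : ℝ) ≤ ∑ t ∈ Finset.range (T + 1), 2 * (k * (D.numEdges t / (ε * α))) := by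
      have hne : (D.nodes T).Nonempty := Finset.card_pos.1 hN0
      have h1 := D.one_le_numEdges hne
      have h2 := DynPPE.numEdges_le_two_mul (D := D) hα hα1 hε hε2 T
      have h3 : (k : ℝ) * 1 ≤ k * (2 * (D.numEdges T / (ε * α))) :=
        mul_le_mul_of_nonneg_left (h1.trans h2) (by linarith)
      have h4 := Finset.single_le_sum (f := fun t => 2 * (k * (D.numEdges t / (ε * α) : ℝ)))
        (fun t _ => by positivity) (Finset.self_mem_range_succ T)
      linarith
    have hterm : ∀ t, (D.numEvents t : ℝ) + k * (3 * D.numEvents t +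
          34 * (D.numEdges t / (ε * α)) + 40 * (D.numEvents t * D.avgDegree t / (ε * α ^ 2))) +
          2 * (k * (D.numEdges t / (ε * α))) ≤
        40 * ((k : ℝ) * D.numEvents t / α ^ 2 +
          k * D.numEvents t * D.avgDegree t / (ε * α ^ 2) +
          k * D.numEdges t / (ε * α) +
          k * min (D.numNodes t : ℝ) (D.numEdges t / (ε * α))) := by
      intro t
      have hM : (0 : ℝ) ≤ D.numEvents t := Nat.cast_nonneg _
      have h1 : (D.numEvents t : ℝ) ≤ k * D.numEvents t := by nlinarith
      have h2 : (k : ℝ) * D.numEvents t ≤ k * D.numEvents t / α ^ 2 :=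
        le_div_self (by positivity) (by positivity) (pow_le_one₀ hα.le hα1)
      have h3 : (0 : ℝ) ≤ k * min (D.numNodes t : ℝ) (D.numEdges t / (ε * α)) := by positivity
      have h4 : (0 : ℝ) ≤ k * D.numEdges t / (ε * α) := by positivity
      have h5 : (k : ℝ) * (D.numEdges t / (ε * α)) = k * D.numEdges t / (ε * α) := by ring
      have h6 : (k : ℝ) * (D.numEvents t * D.avgDegree t / (ε * α ^ 2)) =
        k * D.numEvents t * D.avgDegree t / (ε * α ^ 2) := by ring
      linarith
    have hsum := Finset.sum_le_sum fun t (_ : t ∈ Finset.range (T + 1)) => hterm t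
    rw [← Finset.mul_sum, Finset.sum_add_distrib] at hsum
    have hsplit : ∑ t ∈ Finset.range (T + 1), ((D.numEvents t : ℝ) +
        k * ((if t = 0 then (1 : ℝ) else 0) + 3 * D.numEvents t +
          34 * (D.numEdges t / (ε * α)) +
          40 * (D.numEvents t * D.avgDegree t / (ε * α ^ 2)))) =
        (k : ℝ) + ∑ t ∈ Finset.range (T + 1), ((D.numEvents t : ℝ) + k * (3 * D.numEvents t +
          34 * (D.numEdges t / (ε * α)) +
          40 * (D.numEvents t * D.avgDegree t / (ε * α ^ 2)))) := by
      have hone : ∑ t ∈ Finset.range (T + 1), (if t = 0 then (k : ℝ) else 0) = k := by simp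
      refine Eq.trans (Finset.sum_congr rfl fun t _ => ?_)
        (Finset.sum_add_distrib.trans (congrArg (· + _) hone))
      split_ifs <;> ring
    rw [hsplit]
    linarith
  have hreal : ∑ S ∈ (D.nodes T).powersetCard k,
      ∑ t ∈ Finset.range (T + 1), (D.numEvents t + ∑ s ∈ S, b t s) ≤
      (D.numNodes T).choose k * (40 * R) := by
    refine le_trans ?_ (mul_le_mul_of_nonneg_left hR' hch.le)
    rw [Finset.sum_comm, Finset.mul_sum]
    refine Finset.sum_le_sum fun t ht => ?_
    have h1 := DynPPE.card_mul_sum_powersetCard (D.nodes T) hk hkT (b t)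
    have h2 := DynPPE.sum_targetBound_le hd hsgn σpos σneg hα hα1 hε hε2 hv hmono
      (Nat.lt_succ_iff.1 (Finset.mem_range.1 ht))
    rw [hcard] at h1
    have h3 := mul_le_mul_of_nonneg_left h2
      (show (0 : ℝ) ≤ k * (D.numNodes T).choose k by positivity)
    rw [← h1] at h3
    rw [Finset.sum_add_distrib, Finset.sum_const, Finset.card_powersetCard, nsmul_eq_mul, hcard,
      mul_add]
    refine add_le_add_right (le_of_mul_le_mul_left (h3.trans (le_of_eq ?_)) hN) _
    ring
  have hfin : ∑ S ∈ (D.nodes T).powersetCard k,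
      ((DynPPE.dynamicPPE D T S α ε hd hsgn σpos σneg).time : ℝ≥0∞) ≤
      ENNReal.ofReal ((D.numNodes T).choose k * (40 * R)) := by
    have := (htotal.mono hreal).toENNReal_le
    rwa [← ENat.toENNRealRingHom_apply, map_sum] at this
  rw [ENNReal.ofReal_mul hch.le, ENNReal.ofReal_natCast] at hfin
  exact ENNReal.div_le_of_le_mul' hfin
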